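/- Let $X$ be a smooth projective geometrically connected curve over $\mathbb F_q$ with function field $K$ and a point $\infty\in X(\mathbb F_q)$, let $A\subset K$ be the ring of functions regular away from $\infty$, and let $L$ be an algebraically closed field containing $K$ (for example $K\subset L\subset\mathbb C_\infty$). For vectors and matrices over $L$, and for $\ell\otimes a\in L\otimes_{\mathbb F_q}A$, write $^{(i)}$ for the twist by $\ell\mapsto \ell^{q^i}$ (with $a$ fixed). Let $J\subset L\otimes A$ be the ideal generated by all $1\otimes a-a\otimes 1$, $a\in A$; it is the maximal ideal of a point $\Xi$, and $\Xi^{(i)}$ ($i\in\mathbb Z$) denotes its twists. Let $\phi:A\to \mathrm{Mat}_d(L)[\tau]$ be an Anderson $A$-module, that is, an $\mathbb F_q$-algebra homomorphism such that the constant term $d[a]$ of $\phi_a$ is $aI$ plus a nilpotent matrix, for each $a\in A$. Let $M=\mathrm{Mat}_{1\times d}(L[\tau])$ be its $A$-motive, where $(\ell\otimes a)\cdot m=\ell\,(m\circ\phi_a)$ and $\tau$ acts by left multiplication, with its standard $L[\tau]$-basis $g_1,\dots,g_d$. Assume that $\phi$ is abelian, that is, $M$ is finitely generated and projective over $L\otimes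 A$. Let $M_K$ be the base change of $M$ to the function field $F=\mathrm{Frac}(L\otimes A)$, with the induced $\tau$. Assume that $\phi$ is $\Xi$-regular: for some $F$-basis $(c_j)$ of $M_K$, the entries and the determinant of the matrix $\Phi$ defined by $\tau(c_1,\dots,c_r)^\top=\Phi(c_1,\dots,c_r)^\top$ are regular at $\Xi^{(i)}$ for all $i\in\mathbb Z$. For $m=\sum_{k,j}c_{k,j}\tau^j g_k\in M$ put $\delta_0^M(m)=(c_{1,0},\dots,c_{d,0})^\top\in L^d$; denote again by $\delta_0^M$ its $(L\otimes A)$-linear extension to the elements of $M_K$ that are regular at $\Xi$, i.e. to the localization of $M$ at $J$. Then $\tau$ is bijective on $M_K$; for all $i\ge 0$ and $1\le k\le d$ the element $\tau^{-i}(g_k)\in M_K$ is regular at $\Xi$, and $\delta_0^M$ takes a well-defined value at it; there is a unique $\mathbb F_q$-linear power series $$\mathrm{Exp}_\phi(\mathbf z)=\sum_{i\ge 0}Q_i\mathbf z^{(i)},\qquad Q_i\in\mathrm{Mat}_{d}(L),$$ with $Q_0=I$ and $\mathrm{Exp}_\phi(d[a]\mathbf z)=\phi_a(\mathrm{Exp}_\phi(\mathbf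 z))$ for all $a\in A$; and its coefficients are $$Q_i=\Bigl(\delta_0^M(\tau^{-i}(g_1))^{(i)},\dots,\delta_0^M(\tau^{-i}(g_d))^{(i)}\Bigr)^{\top}\qquad(i\ge 0),$$ i.e. the $k$-th row of $Q_i$ is the twisted vector $\delta_0^M(\tau^{-i}(g_k))^{(i)}$. -/

import Mathlib

open scoped TensorProduct

noncomputable section

/-! ## The curve and its affine coordinate ring -/

/-- `K` is the function field of a smooth projective geometrically connected curve `X` over the
finite field `Fq`; the closed points of `X` are the valuation rings `O ≠ K` of `K`.
`IsCoordinateRingAway A P` says that `P` is (the valuation ring of) an `Fq`-rational point `∞` of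
`X`, and that `A ⊆ K` is the coordinate ring of the affine curve `X ∖ {∞}`, i.e. the ring of
functions regular away from `∞`: a Dedekind domain, finitely generated over `Fq`, with fraction
field `K`, such that the closed points of `X` at which all functions in `A` are regular are
exactly those different from `∞`. -/
structure IsCoordinateRingAway {Fq K : Type*} [Field Fq] [Field K] [Algebra Fq K]
    (A : Subalgebra Fq K) (P : ValuationSubring K) : Prop where
  finiteType : Algebra.FiniteType Fq A
  isDedekindDomain : IsDedekindDomain A
  isFractionRing : IsFractionRing A K
  ne_top : P ≠ ⊤
  rational : ∀ x ∈ P, ∃ c : Fq, P.valuation (x - algebraMap Fq K c) < 1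
  regular_iff : ∀ O : ValuationSubring K, O ≠ ⊤ → ((∀ a ∈ A, a ∈ O) ↔ O ≠ P)

/-! ## Twisted polynomials -/

section Twisted

variable (Fq L : Type*) [Field Fq] [Fintype Fq] [Field L] [Algebra Fq L]

/-- The action of `ℕ` on `L` through powers of the `q`-Frobenius, `q = #Fq`. -/
@[reducible]
def frobeniusAction : MulSemiringAction (Multiplicative ℕ) L where
  smul n x := x ^ Fintype.card Fq ^ (Multiplicative.toAdd n)
  one_smul x := by
    change x ^ Fintype.card Fq ^ 0 = x
    simp
  mul_smul m n x := by
    change x ^ Fintype.card Fq ^ (m.toAdd + n.toAdd) =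
      (x ^ Fintype.card Fq ^ n.toAdd) ^ Fintype.card Fq ^ m.toAdd
    rw [← pow_mul, pow_add, mul_comm]
  smul_zero n := by
    change (0 : L) ^ Fintype.card Fq ^ n.toAdd = 0
    exact zero_pow (pow_ne_zero _ Fintype.card_ne_zero)
  smul_add n x y := by
    change (x + y) ^ Fintype.card Fq ^ n.toAdd =
      x ^ Fintype.card Fq ^ n.toAdd + y ^ Fintype.card Fq ^ n.toAdd
    have h := map_add ((FiniteField.frobeniusAlgHom Fq L) ^ n.toAdd) x y
    simpa [AlgHom.coe_pow, FiniteField.coe_frobeniusAlgHom, pow_iterate] using h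
  smul_one n := one_pow _
  smul_mul n x y := mul_pow _ _ _

/-- The twisted polynomial ring `L[τ]`: polynomials `∑ cᵢ τ^i` with `τ c = c ^ q τ`. -/
def TwistedPoly : Type _ :=
  let _ := Fq
  SkewPolynomial L

namespace TwistedPoly

instance : Ring (TwistedPoly Fq L) :=
  letI := frobeniusAction Fq L
  inferInstanceAs (Ring (SkewPolynomial L))

/-- Left multiplication by constants. -/
instance : Module L (TwistedPoly Fq L) := inferInstanceAs (Module L (SkewPolynomial L))

instance : Module Fq (TwistedPoly Fq L) := inferInstanceAs (Module Fq (SkewPolynomial L))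

instance : IsScalarTower Fq L (TwistedPoly Fq L) :=
  inferInstanceAs (IsScalarTower Fq L (SkewPolynomial L))

variable {Fq L}

/-- The coefficient of `τ^n`. -/
def coeff (p : TwistedPoly Fq L) (n : ℕ) : L := SkewPolynomial.coeff p n

/-- The monomial `c τ^n`. -/
def monomial (n : ℕ) (c : L) : TwistedPoly Fq L := SkewPolynomial.monomial n c

/-- The variable `τ`. -/
def tau : TwistedPoly Fq L := monomial 1 1

theorem monomial_mul_monomial (m n : ℕ) (b c : L) :
    (monomial m b * monomial n c : TwistedPoly Fq L) =
      monomial (m + n) (b * c ^ Fintype.card Fq ^ m) := by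
  let := frobeniusAction Fq L
  exact SkewMonoidAlgebra.single_mul_single

theorem smul_monomial (n : ℕ) (b c : L) :
    (b • monomial n c : TwistedPoly Fq L) = monomial n (b * c) :=
  SkewPolynomial.smul_monomial n b c

theorem monomial_add (n : ℕ) (b c : L) :
    (monomial n (b + c) : TwistedPoly Fq L) = monomial n b + monomial n c :=
  SkewPolynomial.monomial_add n b c

theorem induction {motive : TwistedPoly Fq L → Prop} (p : TwistedPoly Fq L)
    (h0 : motive 0) (hadd : ∀ p q, motive p → motive q → motive (p + q))
    (hmon : ∀ n c, motive (monomial n c)) : motive p :=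
  SkewPolynomial.induction p h0 fun n r q _ _ hq => hadd _ q (hmon n r) hq

theorem smul_mul (b : L) (p q : TwistedPoly Fq L) : (b • p) * q = b • (p * q) := by
  induction p using induction with
  | h0 => simp
  | hadd p p' h h' => simp only [smul_add, add_mul, h, h']
  | hmon m c =>
    induction q using induction with
    | h0 => simp
    | hadd q q' h h' => simp only [mul_add, smul_add, h, h']
    | hmon n c' => simp only [smul_monomial, monomial_mul_monomial, mul_assoc]

theorem tau_mul_smul (b : L) (p : TwistedPoly Fq L) :
    tau * (b • p) = b ^ Fintype.card Fq • (tau * p) := by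
  induction p using induction with
  | h0 => simp
  | hadd p p' h h' => simp only [smul_add, mul_add, h, h']
  | hmon m c => simp only [tau, smul_monomial, monomial_mul_monomial, pow_one, one_mul, mul_pow]

theorem mul_smul_Fq (b : Fq) (p q : TwistedPoly Fq L) : p * (b • q) = b • (p * q) := by
  simp only [← algebraMap_smul L b]
  induction p using induction with
  | h0 => simp
  | hadd p p' h h' => simp only [add_mul, smul_add, h, h']
  | hmon m c =>
    induction q using induction with
    | h0 => simp
    | hadd q q' h h' => simp only [mul_add, smul_add, h, h']
    | hmon n c' =>
      simp only [smul_monomial, monomial_mul_monomial, mul_pow, ← map_pow,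
        FiniteField.pow_card_pow]
      congr 1
      ring

instance : Algebra Fq (TwistedPoly Fq L) :=
  Algebra.ofModule (fun b p q => by simp only [← algebraMap_smul L b, smul_mul])
    (fun b p q => mul_smul_Fq b p q)

end TwistedPoly

end Twisted

/-! ## Anderson modules -/

section Anderson

variable (Fq A L : Type*) [Field Fq] [Fintype Fq] [CommRing A] [Algebra Fq A]
  [Field L] [Algebra Fq L] [Algebra A L]

/-- A `d`-dimensional Anderson `A`-module over `L`: an `Fq`-algebra homomorphism
`φ : A → Mat_d(L[τ]) = Mat_d(L)[τ]` such that the constant term `d[a]` of each `φ_a` differs from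
the scalar matrix `a` by a nilpotent matrix. -/
structure AndersonModule (d : ℕ) where
  toAlgHom : A →ₐ[Fq] Matrix (Fin d) (Fin d) (TwistedPoly Fq L)
  isNilpotent : ∀ a : A, IsNilpotent
    ((toAlgHom a).map (fun p => p.coeff 0) - Matrix.scalar (Fin d) (algebraMap A L a))

/-- The `q`-Frobenius twist `ℓ ⊗ a ↦ ℓ ^ q ⊗ a` of `L ⊗ A`, an automorphism as `L` is
algebraically closed. -/
def frobeniusTwist [IsAlgClosed L] : (L ⊗[Fq] A) ≃ₐ[Fq] (L ⊗[Fq] A) :=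
  Algebra.TensorProduct.congr
    (AlgEquiv.ofBijective (FiniteField.frobeniusAlgHom Fq L)
      ⟨(FiniteField.frobeniusAlgHom Fq L).toRingHom.injective, fun x =>
        IsAlgClosed.exists_pow_nat_eq x Fintype.card_pos⟩)
    AlgEquiv.refl

/-- The maximal ideal `J` of the point `Ξ` of `Spec (L ⊗ A)`. -/
def idealXi : Ideal (L ⊗[Fq] A) :=
  Ideal.span (Set.range fun a : A => (1 : L) ⊗ₜ[Fq] a - algebraMap A L a ⊗ₜ[Fq] (1 : A))

/-- The maximal ideal of the `i`-th Frobenius twist `Ξ^(i)` of `Ξ`, for `i ∈ ℤ`. -/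
def idealXiTwist [IsAlgClosed L] (i : ℤ) : Ideal (L ⊗[Fq] A) :=
  (idealXi Fq A L).map ((frobeniusTwist Fq A L) ^ i : (L ⊗[Fq] A) ≃ₐ[Fq] (L ⊗[Fq] A))

/-- The function field of the base change of the curve to `L`, i.e. the fraction field of
`L ⊗ A`. -/
abbrev TwistedFunctionField : Type _ := FractionRing (L ⊗[Fq] A)

variable {Fq A L}

/-- Regularity of a rational function at the point with prime ideal `p`. -/
def IsRegularAt (p : Ideal (L ⊗[Fq] A)) (f : TwistedFunctionField Fq A L) : Prop :=
  ∃ s r : L ⊗[Fq] A, s ∉ p ∧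
    algebraMap (L ⊗[Fq] A) (TwistedFunctionField Fq A L) s * f =
      algebraMap (L ⊗[Fq] A) (TwistedFunctionField Fq A L) r

namespace AndersonModule

variable {d : ℕ} (φ : AndersonModule Fq A L d)

/-- The matrix of coefficients of `τ^n` in `φ_a`. -/
def coeffMatrix (a : A) (n : ℕ) : Matrix (Fin d) (Fin d) L :=
  (φ.toAlgHom a).map (fun p => p.coeff n)

/-! ### The exponential function -/

/-- The formal composition of `Fq`-linear power series: if `P(z) = ∑ P_i z^(i)` and
`Q(z) = ∑ Q_i z^(i)`, then `P(Q(z)) = ∑_n (∑_{i+j=n} P_i Q_j^(i)) z^(n)`. -/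
def compSeries (Fq : Type*) [Fintype Fq] {L : Type*} [Field L] {d : ℕ}
    (P Q : ℕ → Matrix (Fin d) (Fin d) L) (n : ℕ) : Matrix (Fin d) (Fin d) L :=
  ∑ ij ∈ Finset.HasAntidiagonal.antidiagonal n, P ij.1 * (Q ij.2).map (fun x => x ^ Fintype.card Fq ^ ij.1)

/-- The series `Exp(z) = ∑ Q_i z^(i)` is an exponential function of `φ`: `Q_0 = I` and
`Exp(d[a] z) = φ_a(Exp(z))` for all `a ∈ A`. -/
def IsExponential (Q : ℕ → Matrix (Fin d) (Fin d) L) : Prop :=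
  Q 0 = 1 ∧ ∀ a : A,
    compSeries Fq Q (fun n => if n = 0 then φ.coeffMatrix a 0 else 0) =
      compSeries Fq (φ.coeffMatrix a) Q

/-! ### The motive of an Anderson module -/

/-- The `A`-motive `M = Hom(φ, 𝔾_a) = Mat_{1×d}(L[τ])` of `φ`. -/
def Motive (_φ : AndersonModule Fq A L d) : Type _ := Fin d → TwistedPoly Fq L

instance : AddCommGroup φ.Motive := inferInstanceAs (AddCommGroup (Fin d → TwistedPoly Fq L))
instance : Module L φ.Motive := inferInstanceAs (Module L (Fin d → TwistedPoly Fq L))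
instance : Module Fq φ.Motive := inferInstanceAs (Module Fq (Fin d → TwistedPoly Fq L))
instance : IsScalarTower Fq L φ.Motive :=
  inferInstanceAs (IsScalarTower Fq L (Fin d → TwistedPoly Fq L))

/-- The action of `a ∈ A` on the motive, `m ↦ m ∘ φ_a`. -/
def actA : A →ₐ[Fq] Module.End Fq φ.Motive :=
  AlgHom.ofLinearMap
    { toFun := fun a =>
        { toFun := fun m => Matrix.vecMul (m : Fin d → TwistedPoly Fq L) (φ.toAlgHom a)
          map_add' := fun m m' => Matrix.add_vecMul _ _ _
          map_smul' := fun c m => Matrix.smul_vecMul c _ _ }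
      map_add' := fun a b => by
        ext1 m
        change Matrix.vecMul (m : Fin d → TwistedPoly Fq L) _ = _
        rw [map_add]
        exact Matrix.vecMul_add _ _ _
      map_smul' := fun c a => by
        ext1 m
        change Matrix.vecMul (m : Fin d → TwistedPoly Fq L) _ = _
        rw [map_smul]
        exact Matrix.vecMul_smul _ _ _ }
    (by
      ext1 m
      change Matrix.vecMul (m : Fin d → TwistedPoly Fq L) (φ.toAlgHom 1) = m
      rw [map_one]
      exact Matrix.vecMul_one _)
    (fun a b => by
      ext1 m
      change Matrix.vecMul (m : Fin d → TwistedPoly Fq L) (φ.toAlgHom (a * b)) =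
        Matrix.vecMul (Matrix.vecMul (m : Fin d → TwistedPoly Fq L) (φ.toAlgHom b))
          (φ.toAlgHom a)
      rw [mul_comm a b, map_mul]
      exact (Matrix.vecMul_vecMul _ _ _).symm)

theorem smul_actA (c : L) (a : A) (m : φ.Motive) : φ.actA a (c • m) = c • φ.actA a m := by
  funext k
  change ∑ l, (c • (m l : TwistedPoly Fq L)) * φ.toAlgHom a l k =
    c • ∑ l, (m l : TwistedPoly Fq L) * φ.toAlgHom a l k
  simp only [TwistedPoly.smul_mul, Finset.smul_sum]

theorem commute_actA (c : L) (a : A) :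
    Commute (Algebra.lsmul Fq Fq φ.Motive c) (φ.actA a) := by
  ext1 m
  exact (φ.smul_actA c a m).symm

/-- The action of `L ⊗ A` on the motive: `(c ⊗ a) m = c (m ∘ φ_a)`. -/
def act : L ⊗[Fq] A →ₐ[Fq] Module.End Fq φ.Motive :=
  Algebra.TensorProduct.lift (Algebra.lsmul Fq Fq φ.Motive) φ.actA φ.commute_actA

instance : Module (L ⊗[Fq] A) φ.Motive := Module.compHom φ.Motive φ.act.toRingHom

theorem tmul_smul (c : L) (a : A) (m : φ.Motive) : (c ⊗ₜ[Fq] a) • m = c • φ.actA a m := by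
  change Algebra.TensorProduct.lift (Algebra.lsmul Fq Fq φ.Motive) φ.actA φ.commute_actA
    (c ⊗ₜ[Fq] a) m = _
  rw [Algebra.TensorProduct.lift_tmul]
  rfl

/-- The `τ`-action on the motive, `m ↦ τ m`. -/
def tauM : φ.Motive →+ φ.Motive where
  toFun m := fun k => (TwistedPoly.tau * m k : TwistedPoly Fq L)
  map_zero' := funext fun _ => mul_zero _
  map_add' _ _ := funext fun _ => mul_add _ _ _

/-- The `L[τ]`-basis `g_1, …, g_d` of `M = Mat_{1×d}(L[τ])`, with respect to which `a ∈ A` acts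
by the matrix `φ_a`. -/
def g (k : Fin d) : φ.Motive := (Pi.single k 1 : Fin d → TwistedPoly Fq L)

/-- The map `δ₀ : M → L^d` sending `∑_{k,j} c_{k,j} τ^j g_k` to `(c_{1,0}, …, c_{d,0})`. -/
def deltaZero (m : φ.Motive) : Fin d → L := fun k => TwistedPoly.coeff (m k) 0

/-- `φ` is abelian: its motive is finitely generated and projective over `L ⊗ A`. -/
def IsAbelian : Prop :=
  Module.Finite (L ⊗[Fq] A) φ.Motive ∧ Module.Projective (L ⊗[Fq] A) φ.Motive

/-- The base change `M_K` of the motive to the function field `Frac(L ⊗ A)`. -/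
abbrev MotiveK : Type _ := LocalizedModule (nonZeroDivisors (L ⊗[Fq] A)) φ.Motive

/-- The canonical map `M → M_K`. -/
def toMotiveK : φ.Motive →ₗ[L ⊗[Fq] A] φ.MotiveK :=
  LocalizedModule.mkLinearMap (nonZeroDivisors (L ⊗[Fq] A)) φ.Motive

/-- The element `x ∈ M_K` is regular at `Ξ`, i.e. lies in the localization of `M` at `Ξ`. -/
def IsRegularAtXi (x : φ.MotiveK) : Prop :=
  ∃ s : L ⊗[Fq] A, s ∉ idealXi Fq A L ∧ ∃ m : φ.Motive, s • x = φ.toMotiveK m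

/-- `v` is a value at `x ∈ M_K` of the `(L ⊗ A)`-linear extension of `δ₀` to the localization
`M_Ξ ⊆ M_K`: `v = δ₀(m₀)` for some `m₀ ∈ M` such that `x - m₀` lies in the localization at `Ξ` of
the kernel of `δ₀`. -/
def IsDeltaZeroValue (x : φ.MotiveK) (v : Fin d → L) : Prop :=
  ∃ m₀ : φ.Motive, φ.deltaZero m₀ = v ∧
    ∃ s : L ⊗[Fq] A, s ∉ idealXi Fq A L ∧
      ∃ m : φ.Motive, φ.deltaZero m = 0 ∧ s • (x - φ.toMotiveK m₀) = φ.toMotiveK m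

open Classical in
/-- The extension of `δ₀` to the elements of `M_K` that are regular at `Ξ` (and the junk value `0`
where it is not defined). -/
def deltaZeroK (x : φ.MotiveK) : Fin d → L :=
  if h : ∃ v, φ.IsDeltaZeroValue x v then h.choose else 0

variable [IsAlgClosed L]

theorem tauM_smul (r : L ⊗[Fq] A) (m : φ.Motive) :
    φ.tauM (r • m) = frobeniusTwist Fq A L r • φ.tauM m := by
  induction r using TensorProduct.induction_on with
  | zero => simp
  | add r r' h h' => simp only [add_smul, map_add, h, h']
  | tmul c a =>
    have hc : frobeniusTwist Fq A L (c ⊗ₜ[Fq] a) = (c ^ Fintype.card Fq) ⊗ₜ[Fq] a := rfl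
    rw [hc, tmul_smul, tmul_smul]
    funext k
    change TwistedPoly.tau * (c • ∑ l, (m l : TwistedPoly Fq L) * φ.toAlgHom a l k) =
      c ^ Fintype.card Fq •
        ∑ l, (TwistedPoly.tau * m l : TwistedPoly Fq L) * φ.toAlgHom a l k
    rw [TwistedPoly.tau_mul_smul, Finset.mul_sum]
    simp only [mul_assoc]

/-- The Frobenius twist on the denominators. -/
def twistDenom (s : nonZeroDivisors (L ⊗[Fq] A)) : nonZeroDivisors (L ⊗[Fq] A) :=
  ⟨frobeniusTwist Fq A L s, by
    refine mem_nonZeroDivisors_iff_right.mpr fun x hx => ?_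
    have h : (frobeniusTwist Fq A L).symm x * s = 0 := by
      apply (frobeniusTwist Fq A L).injective
      simpa using hx
    simpa using mem_nonZeroDivisors_iff_right.mp s.2 _ h⟩

/-- The `τ`-action on `M_K`, `τ(m / s) = τ(m) / s^(1)`. -/
def tauK (x : φ.MotiveK) : φ.MotiveK :=
  LocalizedModule.liftOn x (fun p => LocalizedModule.mk (φ.tauM p.1) (twistDenom p.2)) (by
    rintro ⟨m, s⟩ ⟨m', s'⟩ ⟨u, hu⟩
    refine LocalizedModule.mk_eq.mpr ⟨twistDenom u, ?_⟩
    have h := congrArg φ.tauM hu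
    simp only [Submonoid.smul_def, tauM_smul] at h
    exact h)

/-- The matrix `Φ` of `τ` in a basis `c` of `M_K`: `τ (c_i) = ∑_j Φ_{ij} c_j`. -/
def tauMatrix {r : ℕ} (c : Module.Basis (Fin r) (TwistedFunctionField Fq A L) φ.MotiveK) :
    Matrix (Fin r) (Fin r) (TwistedFunctionField Fq A L) :=
  Matrix.of fun i j => c.repr (φ.tauK (c i)) j

/-- `φ` is `Ξ`-regular: for some basis of `M_K` over the function field, all coordinates of `Φ`
and `det Φ` are regular at `Ξ^(i)` for all `i ∈ ℤ`. -/
def IsXiRegular : Prop :=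
  ∃ (r : ℕ) (c : Module.Basis (Fin r) (TwistedFunctionField Fq A L) φ.MotiveK), ∀ i : ℤ,
    IsRegularAt (idealXiTwist Fq A L i) (φ.tauMatrix c).det ∧
      ∀ j k, IsRegularAt (idealXiTwist Fq A L i) (φ.tauMatrix c j k)

end AndersonModule

end Anderson

end

/-! Since `L` is perfect, an element of $M$ with zero constant term is left divisible by $\tau$. So
$\ker\delta_0=\tau M$ and $M/\tau M\cong L^d$, with $a$ acting through $d[a]$. As $d[a]-a$ is
nilpotent, a power of each generator of $J$ kills $M/\tau M$: the cokernel of $\tau$ is supported at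
$\Xi$ (`idealXi_le_radical`). Hence a function not vanishing at $\Xi$ is invertible on $M/\tau M$.
This extends $\delta_0$ to $M_\Xi$, uniquely because $M\to M_K$ is injective for projective $M$.

Fix $a$ with a pole at $\infty$ and put $\xi=1\otimes a-a\otimes 1$. Then $\xi$ is not a zero
divisor and $\xi^N M\subseteq\tau M$ for some $N$, so $\tau$ is bijective on $M_K$. The denominators
of $\tau^{-n}(M)$ divide products of powers of $\xi^{(-1)},\dots,\xi^{(-n)}$, and none of these
vanishes at $\Xi$ because $a^{q^j}\ne a$ for $j\ge 1$ (`isRegularAtXi_tauInv_iterate`).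

Let $E_n(m)=\delta_0(\tau^{-n}m)^{(n)}$. It is $L$-linear in $m$, satisfies
$E_n(am)=E_n(m)\,d[a]^{(n)}$ and $E_{n+1}(\tau m)=E_n(m)^{(1)}$. Peeling off powers of $\tau$
identifies $E_n(m)$ with the $n$-th coefficient of $m\circ\sum_j Q_j z^{(j)}$, where $Q_j$ has rows
$E_j(g_k)$ (`twistedValue_eq_sum`). Computing $E_n(a g_k)$ in both ways is the functional equation.
Uniqueness follows coefficient by coefficient from a Sylvester equation
(`Matrix.eq_zero_of_mul_eq_mul`). -/

noncomputable section

set_option linter.unusedSectionVars false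

/-! ### Constant terms and left division by $\tau$ in $L[\tau]$. -/

section Twisted

namespace TwistedPoly

variable {Fq L : Type*} [Field Fq] [Fintype Fq] [Field L] [Algebra Fq L]

@[simp]
theorem coeff_zero (n : ℕ) : coeff (0 : TwistedPoly Fq L) n = 0 := rfl

@[simp]
theorem coeff_add (p q : TwistedPoly Fq L) (n : ℕ) : coeff (p + q) n = coeff p n + coeff q n :=
  congrFun (congrArg DFunLike.coe (SkewMonoidAlgebra.coeff_add (G := Multiplicative ℕ) p q)) _

theorem coeff_monomial (m n : ℕ) (c : L) :
    coeff (monomial m c : TwistedPoly Fq L) n = if m = n then c else 0 :=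
  SkewPolynomial.coeff_monomial

theorem monomial_zero (n : ℕ) : (monomial n 0 : TwistedPoly Fq L) = 0 :=
  SkewPolynomial.monomial_zero_right n

theorem coeff_one_zero : coeff (1 : TwistedPoly Fq L) 0 = 1 := by
  let := frobeniusAction Fq L
  exact SkewPolynomial.coeff_one_zero

theorem smul_one (c : L) : c • (1 : TwistedPoly Fq L) = monomial 0 c := by
  have h : (1 : TwistedPoly Fq L) = monomial 0 1 := rfl
  rw [h, smul_monomial, mul_one]

@[ext]
theorem ext {p q : TwistedPoly Fq L} (h : ∀ n, coeff p n = coeff q n) : p = q :=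
  SkewPolynomial.ext h

theorem tau_mul_monomial (n : ℕ) (c : L) :
    (tau * monomial n c : TwistedPoly Fq L) = monomial (n + 1) (c ^ Fintype.card Fq) := by
  rw [tau, monomial_mul_monomial, one_mul, pow_one, add_comm]

theorem add_pow_card (x y : L) :
    (x + y) ^ Fintype.card Fq = x ^ Fintype.card Fq + y ^ Fintype.card Fq :=
  map_add (FiniteField.frobeniusAlgHom Fq L) x y

theorem coeff_succ_tau_mul (p : TwistedPoly Fq L) (n : ℕ) :
    coeff (tau * p) (n + 1) = coeff p n ^ Fintype.card Fq := by
  induction p using induction with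
  | h0 => simp [Fintype.card_ne_zero]
  | hadd p q hp hq => rw [mul_add, coeff_add, hp, hq, coeff_add, add_pow_card]
  | hmon m c =>
    rw [tau_mul_monomial, coeff_monomial, coeff_monomial]
    by_cases h : m = n <;> simp [h, Fintype.card_ne_zero]

theorem coeff_zero_mul (p q : TwistedPoly Fq L) :
    coeff (p * q) 0 = coeff p 0 * coeff q 0 := by
  induction p using induction with
  | h0 => simp
  | hadd p p' hp hp' => rw [add_mul, coeff_add, hp, hp', coeff_add, add_mul]
  | hmon m b =>
    induction q using induction with
    | h0 => simp
    | hadd q q' hq hq' => rw [mul_add, coeff_add, hq, hq', coeff_add, mul_add]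
    | hmon n c =>
      rw [monomial_mul_monomial]
      simp only [coeff_monomial]
      rcases m with _ | m <;> rcases n with _ | n <;> simp

/-- The ring homomorphism taking a twisted polynomial to its constant term. -/
def constantCoeff : TwistedPoly Fq L →+* L where
  toFun p := coeff p 0
  map_one' := coeff_one_zero
  map_mul' := coeff_zero_mul
  map_zero' := rfl
  map_add' p q := coeff_add p q 0

theorem tau_mul_injective : Function.Injective (fun p : TwistedPoly Fq L => tau * p) := by
  intro p q h
  ext n
  have h' := congrArg (fun r => coeff r (n + 1)) h
  simp only [coeff_succ_tau_mul] at h'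
  exact (FiniteField.frobeniusAlgHom Fq L).toRingHom.injective h'

/-- Moving $\tau$ to the left of a coefficient requires its $q$-th root, which is where algebraic
closedness enters. -/
theorem exists_eq_add_tau_mul [IsAlgClosed L] (p : TwistedPoly Fq L) :
    ∃ q : TwistedPoly Fq L, p = monomial 0 (coeff p 0) + tau * q := by
  induction p using induction with
  | h0 => exact ⟨0, by simp [monomial_zero]⟩
  | hadd p p' hp hp' =>
    obtain ⟨q, hq⟩ := hp
    obtain ⟨q', hq'⟩ := hp'
    refine ⟨q + q', ?_⟩
    conv_lhs => rw [hq, hq']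
    rw [coeff_add, monomial_add, mul_add]
    abel
  | hmon n c =>
    rcases n with _ | n
    · exact ⟨0, by simp [coeff_monomial]⟩
    · obtain ⟨z, hz⟩ := IsAlgClosed.exists_pow_nat_eq c (Fintype.card_pos (α := Fq))
      exact ⟨monomial n z, by simp [coeff_monomial, tau_mul_monomial, hz, monomial_zero]⟩

end TwistedPoly

end Twisted

section Anderson

variable {Fq A L : Type*} [Field Fq] [Fintype Fq] [CommRing A] [Algebra Fq A]
  [Field L] [Algebra Fq L] [Algebra A L]

/-! ## The point `Ξ` -/

variable (Fq) in
/-- The function `1 ⊗ a - a ⊗ 1`, which vanishes at `Ξ`. -/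
def xiFunction (L : Type*) [Field L] [Algebra Fq L] [Algebra A L] (a : A) : L ⊗[Fq] A :=
  (1 : L) ⊗ₜ[Fq] a - algebraMap A L a ⊗ₜ[Fq] (1 : A)

theorem xiFunction_mem_idealXi (a : A) : xiFunction Fq L a ∈ idealXi Fq A L :=
  Ideal.subset_span ⟨a, rfl⟩

variable (Fq A L) in
/-- The evaluation `ℓ ⊗ a ↦ ℓ a` at the point `Ξ`. -/
def evalXi [IsScalarTower Fq A L] : L ⊗[Fq] A →ₐ[Fq] L :=
  Algebra.TensorProduct.lift (AlgHom.id Fq L) (IsScalarTower.toAlgHom Fq A L)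
    fun _ _ => Commute.all _ _

@[simp]
theorem evalXi_tmul [IsScalarTower Fq A L] (c : L) (a : A) :
    evalXi Fq A L (c ⊗ₜ a) = c * algebraMap A L a := by
  simp [evalXi]

/-- Modulo $J$ one may replace $1\otimes a$ by $a\otimes 1$, so every function is congruent to its
value at $\Xi$. -/
theorem evalXi_tmul_one_sub_mem [IsScalarTower Fq A L] (s : L ⊗[Fq] A) :
    evalXi Fq A L s ⊗ₜ[Fq] (1 : A) - s ∈ idealXi Fq A L := by
  induction s using TensorProduct.induction_on with
  | zero => simp
  | add x y hx hy =>
    have h := add_mem hx hy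
    rw [map_add, TensorProduct.add_tmul]
    convert h using 1
    abel
  | tmul c a =>
    have h := (idealXi Fq A L).mul_mem_left (-(c ⊗ₜ[Fq] (1 : A)))
      (xiFunction_mem_idealXi (Fq := Fq) (L := L) a)
    convert h using 1
    rw [xiFunction, mul_sub]
    simp only [evalXi_tmul, neg_mul, Algebra.TensorProduct.tmul_mul_tmul, one_mul, mul_one]
    abel

theorem mem_idealXi_iff [IsScalarTower Fq A L] {s : L ⊗[Fq] A} :
    s ∈ idealXi Fq A L ↔ evalXi Fq A L s = 0 := by
  constructor
  · intro h
    have hle : idealXi Fq A L ≤ RingHom.ker (evalXi Fq A L) := by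
      rw [idealXi, Ideal.span_le]
      rintro _ ⟨a, rfl⟩
      simp [RingHom.mem_ker]
    exact hle h
  · intro h
    simpa [h] using evalXi_tmul_one_sub_mem s

/-- If `1 ⊗ a - a ⊗ 1` kills `x`, then multiplication by `a` preserves the finite set of all
`(f ⊗ 1)(x)` with `f : L → 𝔽_q` linear. -/
theorem xiFunction_mem_nonZeroDivisors [IsDomain A] {a : A}
    (ha : Function.Injective fun n : ℕ => a ^ n) :
    xiFunction Fq L a ∈ nonZeroDivisors (L ⊗[Fq] A) := by
  rw [mem_nonZeroDivisors_iff]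
  suffices h : ∀ x : L ⊗[Fq] A, xiFunction Fq L a * x = 0 → x = 0 from
    ⟨h, fun x hx => h x (by rwa [mul_comm])⟩
  intro x hx
  let F : Module.Dual Fq L → L ⊗[Fq] A →ₗ[Fq] A :=
    fun f => (TensorProduct.lid Fq A).toLinearMap ∘ₗ f.rTensor A
  have hF : ∀ f c b, F f (c ⊗ₜ b) = f c • b := fun f c b => by simp [F]
  have hmul : ∀ f : Module.Dual Fq L, a * F f x =
      F (f ∘ₗ LinearMap.mulLeft Fq (algebraMap A L a)) x := by
    intro f
    have h1 : ∀ y : L ⊗[Fq] A, a * F f y = F f ((1 : L) ⊗ₜ a * y) := by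
      intro y
      induction y using TensorProduct.induction_on with
      | zero => simp
      | add y z hy hz => rw [map_add, mul_add, hy, hz, mul_add, map_add]
      | tmul c b => rw [Algebra.TensorProduct.tmul_mul_tmul, hF, hF, one_mul, mul_smul_comm]
    have h2 : ∀ y : L ⊗[Fq] A, F (f ∘ₗ LinearMap.mulLeft Fq (algebraMap A L a)) y =
        F f (algebraMap A L a ⊗ₜ (1 : A) * y) := by
      intro y
      induction y using TensorProduct.induction_on with
      | zero => simp
      | add y z hy hz => rw [map_add, hy, hz, mul_add, map_add]
      | tmul c b =>
        rw [Algebra.TensorProduct.tmul_mul_tmul, hF, hF, one_mul, LinearMap.comp_apply,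
          LinearMap.mulLeft_apply]
    have h3 : (1 : L) ⊗ₜ[Fq] a * x = algebraMap A L a ⊗ₜ[Fq] (1 : A) * x := by
      rwa [← sub_eq_zero, ← sub_mul]
    rw [h1, h2, h3]
  have hfin : (Set.range fun f : Module.Dual Fq L => F f x).Finite := by
    -- As a finite sum of pure tensors, `x` has all its values in one finite-dimensional $\mathbb
    -- F_q$-space, which is a finite set.
    obtain ⟨S, hS⟩ : ∃ S : Submodule Fq A, S.FG ∧ ∀ f, F f x ∈ S := by
      clear hx hmul
      induction x using TensorProduct.induction_on with
      | zero => exact ⟨⊥, Submodule.fg_bot, fun f => by simp⟩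
      | add y z hy hz =>
        obtain ⟨S, hS, hSy⟩ := hy
        obtain ⟨T, hT, hTz⟩ := hz
        refine ⟨S ⊔ T, hS.sup hT, fun f => ?_⟩
        rw [map_add]
        exact Submodule.add_mem_sup (hSy f) (hTz f)
      | tmul c b =>
        refine ⟨Fq ∙ b, Submodule.fg_span_singleton b, fun f => ?_⟩
        rw [hF]
        exact Submodule.smul_mem _ _ (Submodule.mem_span_singleton_self b)
    have : Module.Finite Fq S := Module.Finite.iff_fg.mpr hS.1
    have : Finite S := Module.finite_of_finite Fq
    exact (Set.toFinite (S : Set A)).subset (Set.range_subset_iff.mpr hS.2)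
  have hzero : ∀ f, F f x = 0 := by
    intro f
    by_contra hne
    -- In a domain the elements $a^n\cdot F_f(x)$ would be pairwise distinct, too many for a finite
    -- set.
    have hpow : ∀ n : ℕ, a ^ n * F f x ∈ Set.range fun f : Module.Dual Fq L => F f x := by
      intro n
      induction n with
      | zero => exact ⟨f, by simp⟩
      | succ n ih =>
        obtain ⟨f', hf'⟩ := ih
        exact ⟨_, (hmul f').symm.trans (by rw [pow_succ', mul_assoc, ← hf'])⟩
    have hinj : Function.Injective fun n : ℕ => a ^ n * F f x := fun m n h =>
      ha (mul_right_cancel₀ hne h)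
    exact Set.infinite_of_injective_forall_mem hinj hpow hfin
  classical
  let B := Module.Basis.ofVectorSpace Fq L
  apply (TensorProduct.equivFinsuppOfBasisLeft (N := A) B).injective
  ext i
  rw [TensorProduct.equivFinsuppOfBasisLeft_apply, map_zero]
  exact hzero (B.coord i)

/-! ### Inverse Frobenius twists of $\Xi$. -/

section Twist

variable [IsAlgClosed L]

@[simp]
theorem frobeniusTwist_tmul (c : L) (a : A) :
    frobeniusTwist Fq A L (c ⊗ₜ a) = (c ^ Fintype.card Fq) ⊗ₜ a :=
  rfl

/-- The twisted function is $1\otimes a-a^{1/q^n}\otimes 1$, with value $a-a^{1/q^n}$ at $\Xi$. -/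
theorem evalXi_frobeniusTwist_symm_iterate_xiFunction_ne_zero [IsScalarTower Fq A L] {a : A}
    {n : ℕ} (ha : algebraMap A L a ^ Fintype.card Fq ^ n ≠ algebraMap A L a) :
    evalXi Fq A L ((frobeniusTwist Fq A L).symm^[n] (xiFunction Fq L a)) ≠ 0 := by
  have key : ∀ n : ℕ, ∃ z : L, z ^ Fintype.card Fq ^ n = algebraMap A L a ∧
      (frobeniusTwist Fq A L).symm^[n] (xiFunction Fq L a) = (1 : L) ⊗ₜ a - z ⊗ₜ (1 : A) := by
    intro n
    induction n with
    | zero => exact ⟨algebraMap A L a, by simp, rfl⟩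
    | succ n ih =>
      obtain ⟨z, hz, h⟩ := ih
      obtain ⟨w, hw⟩ := IsAlgClosed.exists_pow_nat_eq z (Fintype.card_pos (α := Fq))
      refine ⟨w, by rw [pow_succ', pow_mul, hw, hz], ?_⟩
      rw [Function.iterate_succ_apply', h, AlgEquiv.symm_apply_eq]
      simp [hw]
  obtain ⟨z, hz, h⟩ := key n
  rw [h]
  intro h0
  have hza : algebraMap A L a = z := by simpa [sub_eq_zero] using h0
  exact ha (by rw [hza, hz, hza])

end Twist

namespace AndersonModule

variable {d : ℕ} (φ : AndersonModule Fq A L d)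

/-! ## The map `δ₀` on the motive -/

theorem deltaZero_add (m m' : φ.Motive) :
    φ.deltaZero (m + m') = φ.deltaZero m + φ.deltaZero m' :=
  funext fun k => TwistedPoly.coeff_add (m k) (m' k) 0

theorem deltaZero_zero : φ.deltaZero 0 = 0 := rfl

theorem deltaZero_sub (m m' : φ.Motive) :
    φ.deltaZero (m - m') = φ.deltaZero m - φ.deltaZero m' := by
  rw [eq_sub_iff_add_eq, ← deltaZero_add, sub_add_cancel]

theorem deltaZero_tmul_smul (c : L) (a : A) (m : φ.Motive) :
    φ.deltaZero ((c ⊗ₜ[Fq] a) • m) = c • Matrix.vecMul (φ.deltaZero m) (φ.coeffMatrix a 0) := by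
  rw [tmul_smul]
  funext k
  change c * TwistedPoly.constantCoeff (∑ l, (m l : TwistedPoly Fq L) * φ.toAlgHom a l k) =
    c * ∑ l, φ.deltaZero m l * φ.coeffMatrix a 0 l k
  rw [map_sum]
  simp only [map_mul]
  rfl

theorem deltaZero_xiFunction_pow_smul (a : A) (n : ℕ) (m : φ.Motive) :
    φ.deltaZero (xiFunction Fq L a ^ n • m) = Matrix.vecMul (φ.deltaZero m)
      ((φ.coeffMatrix a 0 - Matrix.scalar (Fin d) (algebraMap A L a)) ^ n) := by
  induction n with
  | zero => simp
  | succ n ih =>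
    rw [pow_succ', mul_smul, xiFunction, sub_smul, deltaZero_sub, deltaZero_tmul_smul,
      deltaZero_tmul_smul, ← xiFunction, ih, pow_succ, ← Matrix.vecMul_vecMul, Matrix.vecMul_sub]
    have h1 : φ.coeffMatrix 1 0 = 1 := by
      rw [coeffMatrix, map_one]
      exact Matrix.map_one _ rfl TwistedPoly.coeff_one_zero
    rw [h1]
    simp

/-- The kernel of `δ₀` as an `L ⊗ A`-submodule of the motive. -/
def kerDeltaZero : Submodule (L ⊗[Fq] A) φ.Motive where
  carrier := {m | φ.deltaZero m = 0}
  add_mem' {m m'} hm hm' := by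
    rw [Set.mem_ofPred_eq] at *
    rw [deltaZero_add, hm, hm', add_zero]
  zero_mem' := φ.deltaZero_zero
  smul_mem' r m hm := by
    rw [Set.mem_ofPred_eq] at *
    induction r using TensorProduct.induction_on with
    | zero => rw [zero_smul, deltaZero_zero]
    | add x y hx hy => rw [add_smul, deltaZero_add, hx, hy, add_zero]
    | tmul c a => rw [deltaZero_tmul_smul, hm, Matrix.zero_vecMul, smul_zero]

theorem mem_kerDeltaZero {m : φ.Motive} : m ∈ φ.kerDeltaZero ↔ φ.deltaZero m = 0 := Iff.rfl

theorem exists_xiFunction_pow_smul_mem (a : A) :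
    ∃ n : ℕ, ∀ m : φ.Motive, xiFunction Fq L a ^ n • m ∈ φ.kerDeltaZero := by
  obtain ⟨n, hn⟩ := φ.isNilpotent a
  refine ⟨n, fun m => ?_⟩
  rw [mem_kerDeltaZero, deltaZero_xiFunction_pow_smul]
  exact (congrArg _ hn).trans (Matrix.vecMul_zero _)

/-- A radical is an ideal, so it suffices to treat the generators, each of which acts nilpotently on
$M/\ker\delta_0$. -/
theorem idealXi_le_radical :
    idealXi Fq A L ≤ (φ.kerDeltaZero.colon (Set.univ : Set φ.Motive)).radical := by
  rw [idealXi, Ideal.span_le]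
  rintro _ ⟨a, rfl⟩
  obtain ⟨n, hn⟩ := φ.exists_xiFunction_pow_smul_mem a
  exact ⟨n, Submodule.mem_colon.mpr fun m _ => hn m⟩

/-- If $c=s(\Xi)\ne 0$, then $c-s\in J$ is nilpotent on $M/\ker\delta_0$, so $s$ is invertible
there. -/
theorem exists_deltaZero_mul_smul_eq [IsScalarTower Fq A L] {s : L ⊗[Fq] A}
    (hs : s ∉ idealXi Fq A L) :
    ∃ t : L ⊗[Fq] A, ∀ m : φ.Motive, φ.deltaZero ((t * s) • m) = φ.deltaZero m := by
  set c := evalXi Fq A L s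
  have hc : c ≠ 0 := fun h => hs (mem_idealXi_iff.mpr h)
  obtain ⟨n, hn⟩ := φ.idealXi_le_radical (evalXi_tmul_one_sub_mem s)
  -- Here $s\,t=c^n-(c-s)^n$ acts as $c^n$ modulo $\ker\delta_0$; dividing by $c^n$ gives the
  -- inverse.
  obtain ⟨t, ht⟩ := sub_dvd_pow_sub_pow (c ⊗ₜ[Fq] (1 : A)) (c ⊗ₜ[Fq] (1 : A) - s) n
  rw [sub_sub_cancel] at ht
  refine ⟨(c ^ n)⁻¹ ⊗ₜ[Fq] (1 : A) * t, fun m => ?_⟩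
  have h1 : ((c ^ n)⁻¹ ⊗ₜ[Fq] (1 : A)) * (c ⊗ₜ[Fq] (1 : A)) ^ n = 1 := by
    rw [Algebra.TensorProduct.tmul_pow, Algebra.TensorProduct.tmul_mul_tmul,
      inv_mul_cancel₀ (pow_ne_zero n hc), one_pow, one_mul, Algebra.TensorProduct.one_def]
  rw [mul_assoc, mul_comm t, ← ht, mul_sub, h1, sub_smul, one_smul, deltaZero_sub,
    sub_eq_self, mul_smul]
  exact φ.kerDeltaZero.smul_mem _ (Submodule.mem_colon.mp hn m trivial)

section Tau

variable [IsAlgClosed L]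

theorem tauM_injective : Function.Injective φ.tauM := fun _ _ h =>
  funext fun k => TwistedPoly.tau_mul_injective (congrFun h k)

/-- The clause on coefficients is what lets `twistedValue_eq_sum` pass from `m` to `m'` by
induction. -/
theorem exists_eq_sum_add_tauM (m : φ.Motive) :
    ∃ m' : φ.Motive, m = ∑ k, φ.deltaZero m k • φ.g k + φ.tauM m' ∧
      ∀ k n, TwistedPoly.coeff (m k) (n + 1) = TwistedPoly.coeff (m' k) n ^ Fintype.card Fq := by
  choose q hq using fun k => TwistedPoly.exists_eq_add_tau_mul (m k : TwistedPoly Fq L)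
  refine ⟨q, funext fun k => (hq k).trans ?_, fun k n => ?_⟩
  swap
  · conv_lhs => rw [hq k]
    rw [TwistedPoly.coeff_add, TwistedPoly.coeff_monomial, if_neg n.succ_ne_zero.symm, zero_add,
      TwistedPoly.coeff_succ_tau_mul]
  have h : ∀ l, (φ.deltaZero m l • φ.g l) k =
      φ.deltaZero m l • (Pi.single l 1 : Fin d → TwistedPoly Fq L) k := fun _ => rfl
  have hs : (∑ l, φ.deltaZero m l • φ.g l : φ.Motive) k =
      ∑ l, (φ.deltaZero m l • φ.g l : φ.Motive) k :=
    Finset.sum_apply (M := fun _ => TwistedPoly Fq L) k Finset.univ fun l => φ.deltaZero m l • φ.g l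
  refine congrArg (· + TwistedPoly.tau * q k) (Eq.trans ?_ hs.symm)
  rw [Finset.sum_eq_single k]
  · rw [h, Pi.single_eq_same, TwistedPoly.smul_one]
    rfl
  · intro l _ hl
    rw [h, Pi.single_eq_of_ne hl.symm, smul_zero]
  · simp

theorem exists_tauM_eq {m : φ.Motive} (hm : m ∈ φ.kerDeltaZero) : ∃ m', φ.tauM m' = m := by
  obtain ⟨m', h, -⟩ := φ.exists_eq_sum_add_tauM m
  rw [mem_kerDeltaZero] at hm
  exact ⟨m', by rw [h, hm]; simp⟩

end Tau

end AndersonModule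

end Anderson

section Anderson

variable {Fq A L : Type*} [Field Fq] [Fintype Fq] [CommRing A] [Algebra Fq A]
  [Field L] [Algebra Fq L] [Algebra A L]

namespace AndersonModule

variable {d : ℕ} (φ : AndersonModule Fq A L d)

/-! ## Values of `δ₀` on the motive over the function field -/

variable {φ} in
theorem IsAbelian.toMotiveK_injective (h : φ.IsAbelian) : Function.Injective φ.toMotiveK := by
  have := h.2
  intro m m' hm
  obtain ⟨u, hu⟩ := LocalizedModule.mk_eq.mp hm
  rw [one_smul, one_smul] at hu
  exact Module.Flat.isSMulRegular_of_nonZeroDivisors u.2 hu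

variable {φ} in
theorem IsDeltaZeroValue.add {x y : φ.MotiveK} {v w : Fin d → L}
    (hx : φ.IsDeltaZeroValue x v) (hy : φ.IsDeltaZeroValue y w) [IsScalarTower Fq A L] :
    φ.IsDeltaZeroValue (x + y) (v + w) := by
  obtain ⟨m₀, rfl, s, hs, m, hm, h⟩ := hx
  obtain ⟨m₁, rfl, t, ht, m', hm', h'⟩ := hy
  refine ⟨m₀ + m₁, φ.deltaZero_add _ _, s * t, ?_, t • m + s • m',
    add_mem (φ.kerDeltaZero.smul_mem t hm) (φ.kerDeltaZero.smul_mem s hm'), ?_⟩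
  · rw [mem_idealXi_iff] at *
    rw [map_mul]
    exact mul_ne_zero hs ht
  · rw [map_add, map_add, map_smul, map_smul, ← h, ← h', smul_smul, smul_smul, mul_comm t s,
      ← smul_add]
    congr 1
    abel

variable {φ} in
theorem IsDeltaZeroValue.tmul_smul {x : φ.MotiveK} {v : Fin d → L}
    (hx : φ.IsDeltaZeroValue x v) (c : L) (a : A) :
    φ.IsDeltaZeroValue ((c ⊗ₜ[Fq] a : L ⊗[Fq] A) • x)
      (c • Matrix.vecMul v (φ.coeffMatrix a 0)) := by
  obtain ⟨m₀, rfl, s, hs, m, hm, h⟩ := hx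
  refine ⟨(c ⊗ₜ[Fq] a : L ⊗[Fq] A) • m₀, φ.deltaZero_tmul_smul _ _ _, s, hs,
    (c ⊗ₜ[Fq] a : L ⊗[Fq] A) • m, φ.kerDeltaZero.smul_mem _ hm, ?_⟩
  rw [map_smul, map_smul, ← smul_sub, smul_comm, h]

theorem isDeltaZeroValue_toMotiveK [IsScalarTower Fq A L] (m : φ.Motive) :
    φ.IsDeltaZeroValue (φ.toMotiveK m) (φ.deltaZero m) :=
  ⟨m, rfl, 1, by simp [mem_idealXi_iff], 0, φ.deltaZero_zero, by simp⟩

variable {φ} in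
-- After clearing denominators the difference of the two lifts is in $\ker\delta_0$; the
-- denominators act invertibly modulo this kernel.
theorem IsDeltaZeroValue.unique [IsScalarTower Fq A L] (hφ : Function.Injective φ.toMotiveK)
    {x : φ.MotiveK} {v w : Fin d → L} (hv : φ.IsDeltaZeroValue x v)
    (hw : φ.IsDeltaZeroValue x w) : v = w := by
  obtain ⟨m₀, rfl, s, hs, m, hm, h⟩ := hv
  obtain ⟨m₁, rfl, t, ht, m', hm', h'⟩ := hw
  obtain ⟨s', hs'⟩ := φ.exists_deltaZero_mul_smul_eq hs
  obtain ⟨t', ht'⟩ := φ.exists_deltaZero_mul_smul_eq ht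
  have key : (s * t) • (m₀ - m₁) = s • m' - t • m := by
    apply hφ
    rw [map_sub, map_smul, map_smul, map_smul, map_sub, ← h, ← h', smul_smul, smul_smul,
      mul_comm t s, ← smul_sub]
    congr 1
    abel
  rw [← sub_eq_zero, ← deltaZero_sub, ← ht', ← hs', ← mul_smul]
  have : s' * s * (t' * t) = (s' * t') * (s * t) := by ring
  rw [this, mul_smul, key]
  exact φ.kerDeltaZero.smul_mem _
    (sub_mem (φ.kerDeltaZero.smul_mem s hm') (φ.kerDeltaZero.smul_mem t hm))

variable {φ} in
theorem IsRegularAtXi.exists_isDeltaZeroValue [IsScalarTower Fq A L] {x : φ.MotiveK}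
    (hx : φ.IsRegularAtXi x) : ∃ v, φ.IsDeltaZeroValue x v := by
  obtain ⟨s, hs, m, h⟩ := hx
  obtain ⟨t, ht⟩ := φ.exists_deltaZero_mul_smul_eq hs
  -- With $x=m/s$, the lift is $tm$, where $t$ inverts $s$ modulo $\ker\delta_0$.
  refine ⟨_, t • m, rfl, s, hs, m - (t * s) • m, ?_, ?_⟩
  · rw [deltaZero_sub, ht, sub_self]
  · rw [smul_sub, h, map_sub, map_smul, map_smul, smul_smul, mul_comm]

variable {φ} in
theorem IsDeltaZeroValue.deltaZeroK_eq [IsScalarTower Fq A L]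
    (hφ : Function.Injective φ.toMotiveK) {x : φ.MotiveK} {v : Fin d → L}
    (hv : φ.IsDeltaZeroValue x v) : φ.deltaZeroK x = v := by
  have h : ∃ v, φ.IsDeltaZeroValue x v := ⟨v, hv⟩
  rw [deltaZeroK, dif_pos h]
  exact h.choose_spec.unique hφ hv

/-! ## Bijectivity of `τ` -/

variable [IsAlgClosed L]

theorem tauK_mk (m : φ.Motive) (s : nonZeroDivisors (L ⊗[Fq] A)) :
    φ.tauK (LocalizedModule.mk m s) = LocalizedModule.mk (φ.tauM m) (twistDenom s) := rfl

theorem tauK_toMotiveK (m : φ.Motive) : φ.tauK (φ.toMotiveK m) = φ.toMotiveK (φ.tauM m) := by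
  have h : twistDenom (1 : nonZeroDivisors (L ⊗[Fq] A)) = 1 := Subtype.ext (map_one _)
  exact (φ.tauK_mk m 1).trans (by rw [h]; rfl)

theorem tauK_add (x y : φ.MotiveK) : φ.tauK (x + y) = φ.tauK x + φ.tauK y := by
  induction x using LocalizedModule.induction_on with | h m s
  induction y using LocalizedModule.induction_on with | h m' s'
  have h : twistDenom (s * s') = twistDenom s * twistDenom s' := Subtype.ext (map_mul _ _ _)
  simp only [LocalizedModule.mk_add_mk, tauK_mk, map_add, Submonoid.smul_def, tauM_smul, h]
  rfl

theorem tauK_smul (r : L ⊗[Fq] A) (x : φ.MotiveK) :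
    φ.tauK (r • x) = frobeniusTwist Fq A L r • φ.tauK x := by
  induction x using LocalizedModule.induction_on with | h m s
  simp only [LocalizedModule.smul'_mk, tauK_mk, tauM_smul]

theorem twistDenom_surjective :
    Function.Surjective (twistDenom : nonZeroDivisors (L ⊗[Fq] A) → _) := by
  intro u
  refine ⟨⟨(frobeniusTwist Fq A L).symm u, mem_nonZeroDivisors_iff_right.mpr fun x hx => ?_⟩,
    Subtype.ext (AlgEquiv.apply_symm_apply _ _)⟩
  have h : frobeniusTwist Fq A L x * u = 0 := by
    apply (frobeniusTwist Fq A L).symm.injective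
    simpa using hx
  simpa using mem_nonZeroDivisors_iff_right.mp u.2 _ h

theorem tauK_injective : Function.Injective φ.tauK := by
  intro x y hxy
  induction x using LocalizedModule.induction_on with | h m s
  induction y using LocalizedModule.induction_on with | h m' s'
  rw [tauK_mk, tauK_mk, LocalizedModule.mk_eq] at hxy
  obtain ⟨u, hu⟩ := hxy
  obtain ⟨u, rfl⟩ := twistDenom_surjective u
  refine LocalizedModule.mk_eq.mpr ⟨u, φ.tauM_injective ?_⟩
  simp only [Submonoid.smul_def, tauM_smul]
  exact hu

/-- Expand $m/s$ to $\xi^n m/(\xi^n s)$: the numerator now lies in $\tau M$. -/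
theorem tauK_surjective {a : A} (ha : xiFunction Fq L a ∈ nonZeroDivisors (L ⊗[Fq] A)) :
    Function.Surjective φ.tauK := by
  intro x
  induction x using LocalizedModule.induction_on with | h m s
  obtain ⟨n, hn⟩ := φ.exists_xiFunction_pow_smul_mem a
  obtain ⟨m', hm'⟩ := φ.exists_tauM_eq (hn m)
  obtain ⟨t, ht⟩ := twistDenom_surjective (⟨_, pow_mem ha n⟩ * s)
  refine ⟨LocalizedModule.mk m' t, ?_⟩
  rw [tauK_mk, ht, hm']
  exact LocalizedModule.mk_cancel_common_left ⟨_, pow_mem ha n⟩ s m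

/-! ## The inverse of `τ` -/

variable {φ} (hτ : Function.Bijective φ.tauK)

/-- The inverse of `τ` on `M_K`. -/
abbrev tauInv : φ.MotiveK → φ.MotiveK := (Equiv.ofBijective φ.tauK hτ).symm

theorem tauInv_eq_iff {x y : φ.MotiveK} : tauInv hτ x = y ↔ x = φ.tauK y :=
  (Equiv.ofBijective φ.tauK hτ).symm_apply_eq

theorem tauK_tauInv (x : φ.MotiveK) : φ.tauK (tauInv hτ x) = x :=
  (Equiv.ofBijective φ.tauK hτ).apply_symm_apply x

theorem tauInv_toMotiveK_tauM (m : φ.Motive) :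
    tauInv hτ (φ.toMotiveK (φ.tauM m)) = φ.toMotiveK m := by
  rw [tauInv_eq_iff, tauK_toMotiveK]

theorem tauInv_add (x y : φ.MotiveK) : tauInv hτ (x + y) = tauInv hτ x + tauInv hτ y := by
  rw [tauInv_eq_iff, tauK_add, tauK_tauInv, tauK_tauInv]

theorem tauInv_smul (r : L ⊗[Fq] A) (x : φ.MotiveK) :
    tauInv hτ (r • x) = (frobeniusTwist Fq A L).symm r • tauInv hτ x := by
  rw [tauInv_eq_iff, tauK_smul, tauK_tauInv, AlgEquiv.apply_symm_apply]

theorem tauInv_iterate_add (n : ℕ) (x y : φ.MotiveK) :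
    (tauInv hτ)^[n] (x + y) = (tauInv hτ)^[n] x + (tauInv hτ)^[n] y := by
  induction n with
  | zero => rfl
  | succ n ih => simp only [Function.iterate_succ_apply', ih, tauInv_add]

theorem tauInv_iterate_smul (n : ℕ) (r : L ⊗[Fq] A) (x : φ.MotiveK) :
    (tauInv hτ)^[n] (r • x) = (frobeniusTwist Fq A L).symm^[n] r • (tauInv hτ)^[n] x := by
  induction n with
  | zero => rfl
  | succ n ih => simp only [Function.iterate_succ_apply', ih, tauInv_smul]

/-- Each application of $\tau^{-1}$ costs one factor $\xi^N$ and then untwists it. The twists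
therefore start at `j + 1`, so that $\xi$ itself, which vanishes at $\Xi$, never occurs. -/
theorem exists_prod_smul_tauInv_iterate (a : A) : ∃ N : ℕ, ∀ (n : ℕ) (m : φ.Motive),
    ∃ m' : φ.Motive,
      (∏ j ∈ Finset.range n, (frobeniusTwist Fq A L).symm^[j + 1] (xiFunction Fq L a) ^ N) •
        (tauInv hτ)^[n] (φ.toMotiveK m) = φ.toMotiveK m' := by
  obtain ⟨N, hN⟩ := φ.exists_xiFunction_pow_smul_mem a
  refine ⟨N, fun n m => ?_⟩
  induction n with
  | zero => exact ⟨m, by simp⟩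
  | succ n ih =>
    obtain ⟨m', hm'⟩ := ih
    obtain ⟨m'', hm''⟩ := φ.exists_tauM_eq (hN m')
    refine ⟨m'', ?_⟩
    rw [← tauInv_toMotiveK_tauM hτ m'', hm'', map_smul, ← hm', smul_smul, tauInv_smul,
      Function.iterate_succ_apply']
    congr 1
    rw [Finset.prod_range_succ', map_mul, map_pow, map_prod, mul_comm]
    simp only [map_pow, Function.iterate_succ_apply', Function.iterate_zero_apply]

theorem isRegularAtXi_tauInv_iterate [IsScalarTower Fq A L] {a : A}
    (ha : ∀ n : ℕ, algebraMap A L a ^ Fintype.card Fq ^ (n + 1) ≠ algebraMap A L a)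
    (n : ℕ) (m : φ.Motive) : φ.IsRegularAtXi ((tauInv hτ)^[n] (φ.toMotiveK m)) := by
  obtain ⟨N, hN⟩ := exists_prod_smul_tauInv_iterate hτ a
  refine ⟨_, ?_, hN n m⟩
  rw [mem_idealXi_iff, map_prod, Finset.prod_eq_zero_iff]
  rintro ⟨j, _, hj⟩
  rw [map_pow] at hj
  exact pow_ne_zero N (evalXi_frobeniusTwist_symm_iterate_xiFunction_ne_zero (ha j)) hj

end AndersonModule

end Anderson

/-- The `q^n`-Frobenius as a ring homomorphism. -/
def frobeniusPow (Fq L : Type*) [Field Fq] [Fintype Fq] [Field L] [Algebra Fq L] (n : ℕ) :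
    L →+* L where
  toFun x := x ^ Fintype.card Fq ^ n
  map_one' := one_pow _
  map_mul' x y := mul_pow x y _
  map_zero' := zero_pow (pow_ne_zero _ Fintype.card_ne_zero)
  map_add' := (frobeniusAction Fq L).smul_add (Multiplicative.ofAdd n)

section Anderson

variable {Fq A L : Type*} [Field Fq] [Fintype Fq] [CommRing A] [Algebra Fq A]
  [Field L] [Algebra Fq L] [Algebra A L]

theorem frobeniusPow_apply (n : ℕ) (x : L) :
    frobeniusPow Fq L n x = x ^ Fintype.card Fq ^ n := rfl

theorem frobeniusPow_comp_vecMul {d : ℕ} (n : ℕ) (v : Fin d → L) (B : Matrix (Fin d) (Fin d) L) :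
    frobeniusPow Fq L n ∘ Matrix.vecMul v B =
      Matrix.vecMul (frobeniusPow Fq L n ∘ v) (B.map (frobeniusPow Fq L n)) :=
  funext fun i => RingHom.map_vecMul _ B v i

namespace AndersonModule

variable {d : ℕ} {φ : AndersonModule Fq A L d}

theorem g_smul_tmul_apply (a : A) (k l : Fin d) :
    ((((1 : L) ⊗ₜ[Fq] a : L ⊗[Fq] A) • φ.g k : φ.Motive) l : TwistedPoly Fq L) =
      φ.toAlgHom a k l := by
  rw [tmul_smul, one_smul]
  exact congrFun (Matrix.single_one_vecMul k (φ.toAlgHom a)) l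

theorem deltaZero_g (k : Fin d) : φ.deltaZero (φ.g k) = Pi.single k 1 := by
  funext l
  change TwistedPoly.constantCoeff ((Pi.single k 1 : Fin d → TwistedPoly Fq L) l) = _
  by_cases h : l = k
  · subst h; simp
  · simp [h]

variable [IsAlgClosed L]

theorem exists_frobeniusTwist_symm_iterate_tmul (n : ℕ) (c : L) (a : A) :
    ∃ z : L, frobeniusPow Fq L n z = c ∧
      (frobeniusTwist Fq A L).symm^[n] (c ⊗ₜ a) = z ⊗ₜ a := by
  induction n with
  | zero => exact ⟨c, by simp [frobeniusPow_apply], rfl⟩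
  | succ n ih =>
    obtain ⟨z, hz, h⟩ := ih
    obtain ⟨w, hw⟩ := IsAlgClosed.exists_pow_nat_eq z (Fintype.card_pos (α := Fq))
    refine ⟨w, ?_, ?_⟩
    · rw [frobeniusPow_apply, pow_succ', pow_mul, hw, ← frobeniusPow_apply, hz]
    · rw [Function.iterate_succ_apply', h, AlgEquiv.symm_apply_eq, frobeniusTwist_tmul, hw]

/-! ## The twisted values of `δ₀` on `τ⁻ⁿ(M)` -/

variable (hτ : Function.Bijective φ.tauK)

/-- The twisted value `δ₀(τ^{-n}(m))^{(n)}`. -/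
def twistedValue (n : ℕ) (m : φ.Motive) : Fin d → L :=
  frobeniusPow Fq L n ∘ φ.deltaZeroK ((tauInv hτ)^[n] (φ.toMotiveK m))

variable [IsScalarTower Fq A L] {hτ} (hφ : Function.Injective φ.toMotiveK)
  (hreg : ∀ (n : ℕ) (m : φ.Motive), φ.IsRegularAtXi ((tauInv hτ)^[n] (φ.toMotiveK m)))

include hφ in
theorem twistedValue_zero (m : φ.Motive) : twistedValue hτ 0 m = φ.deltaZero m := by
  funext k
  rw [twistedValue, Function.iterate_zero_apply,
    (φ.isDeltaZeroValue_toMotiveK m).deltaZeroK_eq hφ]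
  simp [frobeniusPow_apply]

include hφ hreg

theorem isDeltaZeroValue_deltaZeroK (n : ℕ) (m : φ.Motive) :
    φ.IsDeltaZeroValue ((tauInv hτ)^[n] (φ.toMotiveK m))
      (φ.deltaZeroK ((tauInv hτ)^[n] (φ.toMotiveK m))) := by
  obtain ⟨v, hv⟩ := (hreg n m).exists_isDeltaZeroValue
  rwa [hv.deltaZeroK_eq hφ]

theorem twistedValue_add (n : ℕ) (m m' : φ.Motive) :
    twistedValue hτ n (m + m') = twistedValue hτ n m + twistedValue hτ n m' := by
  have h := (isDeltaZeroValue_deltaZeroK hφ hreg n m).add (isDeltaZeroValue_deltaZeroK hφ hreg n m')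
  rw [← tauInv_iterate_add, ← map_add] at h
  rw [twistedValue, h.deltaZeroK_eq hφ]
  exact funext fun k => map_add _ _ _

/-- $\tau^{-n}$ replaces $c$ by $c^{1/q^n}$, and the final twist restores it; the matrix $d[a]$ only
undergoes the final twist. -/
theorem twistedValue_tmul_smul (n : ℕ) (c : L) (a : A) (m : φ.Motive) :
    twistedValue hτ n ((c ⊗ₜ[Fq] a : L ⊗[Fq] A) • m) =
      c • Matrix.vecMul (twistedValue hτ n m)
        ((φ.coeffMatrix a 0).map (frobeniusPow Fq L n)) := by
  obtain ⟨z, hz, h⟩ := exists_frobeniusTwist_symm_iterate_tmul (Fq := Fq) n c a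
  have hv := (isDeltaZeroValue_deltaZeroK hφ hreg n m).tmul_smul z a
  rw [← h, ← tauInv_iterate_smul, ← map_smul] at hv
  rw [twistedValue, hv.deltaZeroK_eq hφ, twistedValue, ← frobeniusPow_comp_vecMul]
  funext k
  simp [hz]

theorem twistedValue_smul (n : ℕ) (c : L) (m : φ.Motive) :
    twistedValue hτ n (c • m) = c • twistedValue hτ n m := by
  have h := twistedValue_tmul_smul hφ hreg n c 1 m
  have h1 : (φ.coeffMatrix 1 0).map (frobeniusPow Fq L n) = 1 := by
    rw [coeffMatrix, map_one, Matrix.map_one _ rfl TwistedPoly.coeff_one_zero,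
      Matrix.map_one _ (map_zero _) (map_one _)]
  rwa [tmul_smul, map_one, Module.End.one_apply, h1, Matrix.vecMul_one] at h

theorem twistedValue_sum (n : ℕ) (c : Fin d → L) :
    twistedValue hτ n (∑ k, c k • φ.g k) =
      Matrix.vecMul c (Matrix.of fun k => twistedValue hτ n (φ.g k)) := by
  let D : φ.Motive →ₗ[L] (Fin d → L) :=
    { toFun := twistedValue hτ n
      map_add' := twistedValue_add hφ hreg n
      map_smul' := twistedValue_smul hφ hreg n }
  have h : D (∑ k, c k • φ.g k) = ∑ k, c k • D (φ.g k) := by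
    rw [map_sum]
    simp only [map_smul]
  rw [Matrix.vecMul_eq_sum]
  exact h

omit hφ hreg in
theorem twistedValue_succ_tauM (n : ℕ) (m : φ.Motive) :
    twistedValue hτ (n + 1) (φ.tauM m) = frobeniusPow Fq L 1 ∘ twistedValue hτ n m := by
  rw [twistedValue, Function.iterate_succ_apply, tauInv_toMotiveK_tauM]
  funext k
  simp only [twistedValue, Function.comp_apply, frobeniusPow_apply]
  rw [← pow_mul, ← pow_add]

/-- The right side is the $n$-th coefficient of $m$ composed with the candidate exponential. Writing
$m=\sum_k\delta_0(m)_k g_k+\tau m'$, the first part gives the term `ij.1 = 0` and the second reduces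
to $m'$ in degree $n$. -/
theorem twistedValue_eq_sum (n : ℕ) (m : φ.Motive) :
    twistedValue hτ n m = ∑ ij ∈ Finset.HasAntidiagonal.antidiagonal n,
      Matrix.vecMul (fun k => TwistedPoly.coeff (m k) ij.1)
        ((Matrix.of fun k => twistedValue hτ ij.2 (φ.g k)).map (frobeniusPow Fq L ij.1)) := by
  induction n generalizing m with
  | zero =>
    have h1 : (Matrix.of fun k => twistedValue hτ 0 (φ.g k)) = 1 := by
      ext k l
      rw [Matrix.of_apply, twistedValue_zero hφ, deltaZero_g, Matrix.one_eq_pi_single]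
    rw [Finset.Nat.antidiagonal_zero, Finset.sum_singleton, h1,
      Matrix.map_one _ (map_zero _) (map_one _), Matrix.vecMul_one, twistedValue_zero hφ]
    rfl
  | succ n ih =>
    obtain ⟨m', hm', hc⟩ := φ.exists_eq_sum_add_tauM m
    have hcoeff : ∀ j, (fun k => TwistedPoly.coeff (m k) (j + 1)) =
        frobeniusPow Fq L 1 ∘ fun k => TwistedPoly.coeff (m' k) j := by
      intro j
      funext k
      rw [hc, Function.comp_apply, frobeniusPow_apply, pow_one]
    rw [Finset.Nat.sum_antidiagonal_succ]
    conv_lhs => rw [hm']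
    rw [twistedValue_add hφ hreg, twistedValue_sum hφ hreg, twistedValue_succ_tauM, ih m']
    congr 1
    · congr 1
      ext k l
      simp [frobeniusPow_apply]
    · funext l
      rw [Function.comp_apply, Finset.sum_apply, Finset.sum_apply, map_sum]
      refine Finset.sum_congr rfl fun ij _ => ?_
      rw [← Function.comp_apply (f := frobeniusPow Fq L 1), frobeniusPow_comp_vecMul, hcoeff]
      refine congrFun (congrArg _ ?_) l
      ext k l
      simp only [Matrix.map_apply, frobeniusPow_apply]
      rw [← pow_mul, ← pow_add]

/-- The element $a g_k$ is the $k$-th row of $\phi_a$, so its twisted value is one side of the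
functional equation by the $A$-action and the other by `twistedValue_eq_sum`. -/
theorem isExponential_twistedValue :
    φ.IsExponential fun n => Matrix.of fun k => twistedValue hτ n (φ.g k) := by
  constructor
  · ext k l
    change twistedValue hτ 0 (φ.g k) l = _
    rw [twistedValue_zero hφ, deltaZero_g, Matrix.one_eq_pi_single]
  · intro a
    funext n
    ext k l
    have h1 := twistedValue_eq_sum hφ hreg n (((1 : L) ⊗ₜ[Fq] a : L ⊗[Fq] A) • φ.g k)
    rw [twistedValue_tmul_smul hφ hreg, one_smul] at h1
    simp only [g_smul_tmul_apply] at h1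
    have h2 := congrFun h1 l
    -- The inner series $d[a]z$ lives in degree $0$, so only one term of the composition survives.
    rw [compSeries, compSeries, Finset.sum_eq_single (n, 0)]
    · rw [Matrix.sum_apply]
      rw [Finset.sum_apply] at h2
      exact h2
    · rintro ⟨i, j⟩ hij hne
      have hj : j ≠ 0 := by
        rintro rfl
        exact hne (by simpa using hij)
      have h0 : (0 : Matrix (Fin d) (Fin d) L).map (frobeniusPow Fq L i) = 0 :=
        Matrix.map_zero _ (map_zero _)
      simp only [if_neg hj]
      exact (congrArg _ h0).trans (Matrix.mul_zero _)
    · simp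

omit hφ hreg [IsScalarTower Fq A L] [IsAlgClosed L]

/-! ## Uniqueness of the exponential function -/

/-- A Sylvester equation whose coefficients have distinct single eigenvalues has only the zero
solution. -/
theorem _root_.Matrix.eq_zero_of_mul_eq_mul {d : ℕ} {B C X : Matrix (Fin d) (Fin d) L} {b c : L}
    (hB : IsNilpotent (B - Matrix.scalar (Fin d) b))
    (hC : IsNilpotent (C - Matrix.scalar (Fin d) c)) (hbc : b ≠ c) (h : X * B = C * X) :
    X = 0 := by
  -- Left and right multiplications commute, so this operator is nilpotent; yet `X` satisfies its
  -- eigenvector equation for $b-c\ne 0$.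
  have hnil : IsNilpotent (LinearMap.mulLeft L (C - Matrix.scalar (Fin d) c) -
      LinearMap.mulRight L (B - Matrix.scalar (Fin d) b)) :=
    (LinearMap.commute_mulLeft_right _ _).isNilpotent_sub
      ((LinearMap.isNilpotent_mulLeft_iff L _).mpr hC)
      ((LinearMap.isNilpotent_mulRight_iff L _).mpr hB)
  have hX : (LinearMap.mulLeft L (C - Matrix.scalar (Fin d) c) -
      LinearMap.mulRight L (B - Matrix.scalar (Fin d) b)) X = (b - c) • X := by
    rw [LinearMap.sub_apply, LinearMap.mulLeft_apply, LinearMap.mulRight_apply, sub_mul, mul_sub, h]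
    ext i j
    simp [Matrix.scalar_apply]
    ring
  obtain ⟨n, hn⟩ := hnil
  have hpow : ∀ n : ℕ, ((LinearMap.mulLeft L (C - Matrix.scalar (Fin d) c) -
      LinearMap.mulRight L (B - Matrix.scalar (Fin d) b)) ^ n) X = (b - c) ^ n • X := by
    intro n
    induction n with
    | zero => simp
    | succ n ih => rw [pow_succ', Module.End.mul_apply, ih, map_smul, hX, smul_smul, pow_succ]
  have h0 := hpow n
  rw [hn, LinearMap.zero_apply] at h0
  exact (smul_eq_zero.mp h0.symm).resolve_left (pow_ne_zero _ (sub_ne_zero.mpr hbc))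

/-- In degree $n+1$ the terms with lower coefficients agree by induction, so the difference $X$
satisfies $X\,d[a]^{(n+1)}=d[a]\,X$, with eigenvalues $a^{q^{n+1}}\ne a$. -/
theorem IsExponential.unique {a : A}
    (ha : ∀ n : ℕ, algebraMap A L a ^ Fintype.card Fq ^ (n + 1) ≠ algebraMap A L a)
    {Q Q' : ℕ → Matrix (Fin d) (Fin d) L} (hQ : φ.IsExponential Q) (hQ' : φ.IsExponential Q') :
    Q = Q' := by
  have key : ∀ {Q : ℕ → Matrix (Fin d) (Fin d) L}, φ.IsExponential Q → ∀ n : ℕ,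
      Q (n + 1) * (φ.coeffMatrix a 0).map (frobeniusPow Fq L (n + 1)) =
        φ.coeffMatrix a 0 * Q (n + 1) + ∑ ij ∈ Finset.HasAntidiagonal.antidiagonal n,
          φ.coeffMatrix a (ij.1 + 1) * (Q ij.2).map (frobeniusPow Fq L (ij.1 + 1)) := by
    intro Q hQ n
    have h := congrFun (hQ.2 a) (n + 1)
    rw [compSeries, compSeries, Finset.sum_eq_single (n + 1, 0),
      Finset.Nat.sum_antidiagonal_succ] at h
    · refine h.trans (congrArg₂ _ ?_ rfl)
      congr 1
      ext k l
      simp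
    · rintro ⟨i, j⟩ hij hne
      have hj : j ≠ 0 := by
        rintro rfl
        exact hne (by simpa using hij)
      have h0 : (0 : Matrix (Fin d) (Fin d) L).map (frobeniusPow Fq L i) = 0 :=
        Matrix.map_zero _ (map_zero _)
      simp only [if_neg hj]
      exact (congrArg _ h0).trans (Matrix.mul_zero _)
    · simp
  funext n
  induction n using Nat.strong_induction_on with
  | _ n ih =>
    rcases n with _ | n
    · rw [hQ.1, hQ'.1]
    · have h := congrArg₂ (· - ·) (key hQ n) (key hQ' n)
      have hsum : ∑ ij ∈ Finset.HasAntidiagonal.antidiagonal n,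
          φ.coeffMatrix a (ij.1 + 1) * (Q ij.2).map (frobeniusPow Fq L (ij.1 + 1)) =
          ∑ ij ∈ Finset.HasAntidiagonal.antidiagonal n,
          φ.coeffMatrix a (ij.1 + 1) * (Q' ij.2).map (frobeniusPow Fq L (ij.1 + 1)) := by
        refine Finset.sum_congr rfl fun ij hij => ?_
        rw [ih ij.2 (Finset.Nat.antidiagonal.snd_lt hij)]
      rw [hsum, add_sub_add_right_eq_sub, ← sub_mul, ← mul_sub] at h
      refine sub_eq_zero.mp (Matrix.eq_zero_of_mul_eq_mul ?_ (φ.isNilpotent a) (ha n) h)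
      have hn := (φ.isNilpotent a).map (frobeniusPow Fq L (n + 1)).mapMatrix
      refine (congrArg IsNilpotent ?_).mp hn
      rw [map_sub]
      refine congrArg₂ _ rfl ?_
      ext k l
      by_cases hkl : k = l <;> simp [Matrix.scalar_apply, hkl, frobeniusPow_apply]

end AndersonModule

end Anderson

/-! ## Functions with a pole at `∞` -/

theorem ValuationSubring.pow_injective_of_notMem {K : Type*} [Field K] {P : ValuationSubring K}
    {a : K} (ha : a ∉ P) : Function.Injective fun n : ℕ => a ^ n := by
  rw [← P.valuation_le_one_iff, not_le] at ha
  intro m n h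
  have h' := congrArg P.valuation h
  simp only [map_pow] at h'
  exact pow_right_injective₀ (zero_lt_one.trans ha) ha.ne' h'

/-- Otherwise all of $A$ would be regular at $\infty$, which `regular_iff` excludes for `P` itself.
-/
theorem IsCoordinateRingAway.exists_notMem {Fq K : Type*} [Field Fq] [Field K] [Algebra Fq K]
    {A : Subalgebra Fq K} {P : ValuationSubring K} (hA : IsCoordinateRingAway A P) :
    ∃ a ∈ A, a ∉ P := by
  by_contra! h
  exact (hA.regular_iff P hA.ne_top).mp h rfl

end

/-- Since `M/τM` is annihilated by a power of `1 ⊗ a - a ⊗ 1`, the map `τ` is an isomorphism away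
from `Ξ`, and the twists `Ξ^(i)` with `i ≠ 0` differ from `Ξ`; hence the regularity of `τ^{-i}(g_k)`
at `Ξ` follows without recourse to the hypothesis that `φ` is `Ξ`-regular. -/
theorem mainTheorem2 {Fq K L : Type*} [Field Fq] [Fintype Fq] [Field K] [Algebra Fq K]
    [Field L] [IsAlgClosed L] [Algebra Fq L] [Algebra K L] [IsScalarTower Fq K L]
    (A : Subalgebra Fq K) (P : ValuationSubring K) (hA : IsCoordinateRingAway A P)
    {d : ℕ} (φ : AndersonModule Fq A L d) (hab : φ.IsAbelian) (hreg : φ.IsXiRegular) :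
    ∃ hτ : Function.Bijective φ.tauK,
      (∀ (i : ℕ) (k : Fin d),
        φ.IsRegularAtXi ((Equiv.ofBijective φ.tauK hτ).symm^[i] (φ.toMotiveK (φ.g k))) ∧
        ∃! v, φ.IsDeltaZeroValue
          ((Equiv.ofBijective φ.tauK hτ).symm^[i] (φ.toMotiveK (φ.g k))) v) ∧
      (∃! Q : ℕ → Matrix (Fin d) (Fin d) L, φ.IsExponential Q) ∧
      ∀ Q : ℕ → Matrix (Fin d) (Fin d) L, φ.IsExponential Q →
        ∀ i : ℕ, Q i = Matrix.of fun k l =>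
          φ.deltaZeroK ((Equiv.ofBijective φ.tauK hτ).symm^[i] (φ.toMotiveK (φ.g k))) l
            ^ Fintype.card Fq ^ i := by
  -- A single function with a pole at $\infty$ suffices: its powers are distinct, so $\xi$ is not a
  -- zero divisor and $a^{q^{n+1}}\ne a$.
  obtain ⟨a, haA, haP⟩ := hA.exists_notMem
  have hpow := ValuationSubring.pow_injective_of_notMem haP
  have hpowA : Function.Injective fun n : ℕ => (⟨a, haA⟩ : A) ^ n := fun m n h =>
    hpow (congrArg Subtype.val h)
  have : IsScalarTower Fq A L := IsScalarTower.of_algebraMap_eq fun x =>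
    IsScalarTower.algebraMap_apply Fq K L x
  have ha : ∀ n : ℕ, algebraMap A L ⟨a, haA⟩ ^ Fintype.card Fq ^ (n + 1) ≠
      algebraMap A L ⟨a, haA⟩ := by
    intro n h
    have h' : a ^ Fintype.card Fq ^ (n + 1) = a ^ 1 := by
      apply (algebraMap K L).injective
      rw [map_pow, pow_one]
      exact h
    exact (Nat.one_lt_pow n.succ_ne_zero Fintype.one_lt_card).ne' (hpow h')
  have hτ : Function.Bijective φ.tauK :=
    ⟨φ.tauK_injective, φ.tauK_surjective (xiFunction_mem_nonZeroDivisors hpowA)⟩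
  have hinj := hab.toMotiveK_injective
  have hXi := AndersonModule.isRegularAtXi_tauInv_iterate hτ ha
  have hexp := AndersonModule.isExponential_twistedValue hinj hXi
  refine ⟨hτ, fun i k => ⟨hXi i _, ?_⟩, ⟨_, hexp, fun Q hQ => hQ.unique ha hexp⟩,
    fun Q hQ i => congrFun (hQ.unique ha hexp) i⟩
  obtain ⟨v, hv⟩ := (hXi i (φ.g k)).exists_isDeltaZeroValue
  exact ⟨v, hv, fun w hw => hw.unique hinj hv⟩
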